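/- Let $k,n\ge 1$, let $\mu$ be the Lebesgue measure on $\mathbb{R}^k$, $|\cdot|_\infty$ the sup norm on $\mathbb{R}^k$, and $\ell(P,Q)=\|P-Q\|=\sup_S|P(S)-Q(S)|$ the total variation loss. Let $\mathcal{M}_0$ be a nonempty set of probability densities on $\mathbb{R}^k$ (with respect to $\mu$), and let $$\mathscr{M}=\Big\{P_{(p,\mathbf m,\sigma)}=\sigma^{-k}p\big(\tfrac{\cdot-\mathbf m}{\sigma}\big)\cdot\mu:\ p\in\mathcal{M}_0,\ \mathbf m\in\mathbb{R}^k,\ \sigma>0\Big\}.$$ Assume the following. (i) There is a continuous nonincreasing function $\widetilde D:(0,\infty)\to[1,\infty)$ with $\eta^{-2}\widetilde D(\eta)\to 0$ as $\eta\to\infty$ and, for all $\eta>0$, a finite set $\mathcal{M}_0[\eta]\subset\mathcal{M}_0$ with $|\mathcal{M}_0[\eta]|\le\exp[\widetilde D(\eta)]$ such that for every $p\in\mathcal{M}_0$ there is $\overline p\in\mathcal{M}_0[\eta]$ with $\ell(P_{(p,\mathbf 0,1)},P_{(\overline p,\mathbf 0,1)})\le\eta$. (ii) There are $A,\alpha>0$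 such that for all $p\in\mathcal{M}_0$, $\mathbf m\in\mathbb{R}^k$ and $\sigma\ge1$, $$\ell(P_{(p,\mathbf 0,1)},P_{(p,\mathbf m,\sigma)})\le\Big[A\Big(\big|\tfrac{\mathbf m}{\sigma}\big|_\infty^{\alpha}+\big(1-\tfrac1\sigma\big)^{\alpha}\Big)\Big]\wedge 1 .$$ Let $K>1$ and set $$\eta_n=\inf\Big\{\eta>0:\widetilde D(\eta)\le\tfrac{n\eta^2}{24}\Big\},\quad \delta_n=\Big(\tfrac{\eta_n}{2A}\Big)^{1/\alpha},\quad \beta=\beta_n=\tfrac12\Big[K\eta_n+2\sqrt{\tfrac{18.6(k+1)}{n}}\Big],$$ and let $\mathscr{M}_n(K)$ be the set of the elements $P_{(p,\mathbf m,\sigma)}$ of $\mathscr{M}$ such that $$|\log\sigma|\vee\big|\tfrac{\mathbf m}{\sigma}\big|_\infty\le\Lambda_n=\exp\Big[\tfrac{(K^2-1)n\eta_n^2}{48(k+1)}+\log\log(1+\delta_n)\Big].$$ Prior: with $\eta=\eta_n$, $\delta=\delta_n$, for $\theta=(\overline p,j_0,\mathbf j)\in\mathcal{M}_0[\eta]\times\mathbb{Z}\times\mathbb{Z}^k$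 let $P_\theta=P_{(\overline p,(1+\delta)^{j_0}\delta\mathbf j,(1+\delta)^{j_0})}$ and $$L_\theta=(k+1)\log\big[\tfrac{\pi^2}{3}-1\big]+\log|\mathcal{M}_0[\eta]|+2\sum_{i=0}^k\log(1+|j_i|).$$ The prior on $\mathscr{M}$ (also denoted $\pi$) is the discrete probability that puts the mass $e^{-L_\theta}$ at $P_\theta$ for each $\theta$, i.e. $\pi=\sum_\theta e^{-L_\theta}\delta_{P_\theta}$ (with $\delta_{P_\theta}$ the Dirac mass at $P_\theta$). Posterior: choose for each $P\in\mathscr{M}$ a density $p$ with respect to $\mu$. For $P=p\cdot\mu$ and $Q=q\cdot\mu$ in $\mathscr{M}$ let $$t_{(P,Q)}=\tfrac12\big[\mathbf 1_{q>p}-Q(q>p)\big]-\tfrac12\big[\mathbf 1_{p>q}-P(p>q)\big],\qquad \mathbf T(\mathbf x,P,Q)=\sum_{i=1}^n t_{(P,Q)}(x_i),$$ and, with $\lambda=4\beta/3$, $$\mathbf T(\mathbf x,P)=\frac{\int_{\mathscr{M}}\mathbf T(\mathbf x,P,Q)\,e^{\lambda\mathbf T(\mathbf x,P,Q)}\,d\pi(Q)}{\int_{\mathscr{M}}e^{\lambda\mathbf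 T(\mathbf x,P,Q)}\,d\pi(Q)},\qquad \frac{d\widehat\pi_{\mathbf x}}{d\pi}(P)=\frac{e^{-\beta\mathbf T(\mathbf x,P)}}{\int_{\mathscr{M}}e^{-\beta\mathbf T(\mathbf x,P')}\,d\pi(P')} .$$ Then there is a numerical constant $\kappa_0'>0$ (depending on nothing) such that, for all independent random variables $X_1,\dots,X_n$ with arbitrary distributions $P_1^\star,\dots,P_n^\star$ on $\mathbb{R}^k$ and all $\xi>0$, writing $\mathbf X=(X_1,\dots,X_n)$ and $\overline P^\star=\frac1n\sum_{i=1}^nP_i^\star$, $$\mathbb{E}\Big[\widehat\pi_{\mathbf X}\big(\{Q\in\mathscr{M}:\ \ell(\overline P^\star,Q)>\kappa_0'r_n\}\big)\Big]\le 2e^{-\xi},$$ where $$r_n=\inf_{P\in\mathscr{M}_n(K)}\ell(\overline P^\star,P)+K\eta_n+\sqrt{\frac{k+1}{n}}+\frac{\xi}{\sqrt n}.$$ -/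

import Mathlib

open MeasureTheory Set Filter Topology
open scoped ENNReal

noncomputable section

namespace LocationScale

/-- The total variation loss `‖P - Q‖ = sup_S |P(S) - Q(S)|`, the supremum being over all
measurable sets `S`. -/
def tvDist {E : Type*} [MeasurableSpace E] (P Q : Measure E) : ℝ :=
  ⨆ S : {S : Set E // MeasurableSet S}, |P.real S.1 - Q.real S.1|

/-! ### The general construction of the posterior distribution -/

section Posterior

variable {E M : Type*} [MeasurableSpace M] {n : ℕ}

/-- `T(x, P, Q) = ∑ i, t_{(P,Q)}(x_i)`. -/
def testSum (t : M → M → E → ℝ) (x : Fin n → E) (P Q : M) : ℝ :=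
  ∑ i, t P Q (x i)

/-- The probability `π̃_x(· | P)` with density proportional to `Q ↦ exp (lam * T(x, P, Q))`
with respect to the prior. -/
def auxPosterior (prior : Measure M) (t : M → M → E → ℝ) (lam : ℝ) (x : Fin n → E) (P : M) :
    Measure M :=
  prior.tilted (fun Q => lam * testSum t x P Q)

/-- `T(x, P) = ∫ T(x, P, Q) dπ̃_x(Q | P)`. -/
def testMean (prior : Measure M) (t : M → M → E → ℝ) (lam : ℝ) (x : Fin n → E) (P : M) : ℝ :=
  ∫ Q, testSum t x P Q ∂(auxPosterior prior t lam x P)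

/-- The posterior distribution `π̂_x`, with density proportional to `P ↦ exp (-β * T(x, P))`
with respect to the prior. -/
def posterior (prior : Measure M) (t : M → M → E → ℝ) (lam β : ℝ) (x : Fin n → E) : Measure M :=
  prior.tilted (fun P => -β * testMean prior t lam x P)

end Posterior

/-- The average distribution `(1/n) ∑ i, P_i`. -/
def average {E : Type*} [MeasurableSpace E] {n : ℕ} (P : Fin n → Measure E) : Measure E :=
  (n : ℝ≥0∞)⁻¹ • ∑ i, P i

/-! ### Densities on `ℝ^k` and the location-scale family

`Fin k → ℝ` carries the sup norm, its Borel σ-algebra and the Lebesgue measure `volume`. -/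

variable {k : ℕ}

/-- `p` is a probability density with respect to the Lebesgue measure on `ℝ^k`. -/
structure IsDensity (p : (Fin k → ℝ) → ℝ) : Prop where
  measurable : Measurable p
  nonneg : ∀ x, 0 ≤ p x
  lintegral_eq_one : ∫⁻ x, ENNReal.ofReal (p x) = 1

/-- The measure `p · μ`, where `μ` is the Lebesgue measure. -/
def densityMeasure (p : (Fin k → ℝ) → ℝ) : Measure (Fin k → ℝ) :=
  volume.withDensity (fun x => ENNReal.ofReal (p x))

/-- `P_{(p,m,σ)} = σ^{-k} p((· - m)/σ) · μ`. -/
def locScale (p : (Fin k → ℝ) → ℝ) (m : Fin k → ℝ) (σ : ℝ) : Measure (Fin k → ℝ) :=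
  densityMeasure (fun x => (σ ^ k)⁻¹ * p (σ⁻¹ • (x - m)))

/-- The location-scale family `{P_{(p,m,σ)} : p ∈ M₀, m ∈ ℝ^k, σ > 0}`. -/
def Model (M₀ : Set ((Fin k → ℝ) → ℝ)) : Type :=
  {P : Measure (Fin k → ℝ) // ∃ p ∈ M₀, ∃ (m : Fin k → ℝ) (σ : ℝ), 0 < σ ∧ P = locScale p m σ}

/-- The priors considered here are discrete: every subset of the model is an event. -/
instance (M₀ : Set ((Fin k → ℝ) → ℝ)) : MeasurableSpace (Model M₀) := ⊤

/-- The closed ball `{Q ∈ 𝓜 : ‖P - Q‖ ≤ r}` for the total variation loss. -/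
def ball (M₀ : Set ((Fin k → ℝ) → ℝ)) (P : Measure (Fin k → ℝ)) (r : ℝ) : Set (Model M₀) :=
  {Q | tvDist P Q.1 ≤ r}

/-- `dens P` is, for every `P` in the model, a density of `P` with respect to the Lebesgue
measure. -/
def IsDensityChoice {M₀ : Set ((Fin k → ℝ) → ℝ)} (dens : Model M₀ → (Fin k → ℝ) → ℝ) : Prop :=
  ∀ P : Model M₀, IsDensity (dens P) ∧ P.1 = densityMeasure (dens P)

open Classical in
/-- The functions `t_{(P,Q)} = (1/2) [1_{q > p} - Q(q > p)] - (1/2) [1_{p > q} - P(p > q)]`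
where `p`, `q` are the densities of `P`, `Q`. -/
def tvTest {M₀ : Set ((Fin k → ℝ) → ℝ)} (dens : Model M₀ → (Fin k → ℝ) → ℝ)
    (P Q : Model M₀) (x : Fin k → ℝ) : ℝ :=
  1 / 2 * ((if dens P x < dens Q x then 1 else 0) - Q.1.real {y | dens P y < dens Q y})
    - 1 / 2 * ((if dens Q x < dens P x then 1 else 0) - P.1.real {y | dens Q y < dens P y})

/-! ### The entropy and regularity assumption -/

/-- `M₀` has its entropy bounded by `D`, with `η`-nets `net η ⊆ M₀`, and the total variation
loss is regular with respect to the location and scale parameters, with constants `A`, `α`. -/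
structure EntropyAssumption (M₀ : Set ((Fin k → ℝ) → ℝ)) (D : ℝ → ℝ) (net : ℝ → Finset M₀)
    (A α : ℝ) : Prop where
  continuousOn : ContinuousOn D (Ioi 0)
  antitoneOn : AntitoneOn D (Ioi 0)
  one_le : ∀ η, 0 < η → 1 ≤ D η
  tendsto : Tendsto (fun η => D η / η ^ 2) atTop (𝓝 0)
  card_le : ∀ η, 0 < η → ((net η).card : ℝ) ≤ Real.exp (D η)
  cover : ∀ η, 0 < η → ∀ p ∈ M₀, ∃ q ∈ net η, tvDist (locScale p 0 1) (locScale q.1 0 1) ≤ η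
  A_pos : 0 < A
  α_pos : 0 < α
  regular : ∀ p ∈ M₀, ∀ (m : Fin k → ℝ) (σ : ℝ), 1 ≤ σ →
    tvDist (locScale p 0 1) (locScale p m σ)
      ≤ min (A * (‖σ⁻¹ • m‖ ^ α + (1 - 1 / σ) ^ α)) 1

/-! ### The parameters -/

/-- `η_n = inf {η > 0 : D(η) ≤ n η² / 24}`. -/
def etaN (D : ℝ → ℝ) (n : ℕ) : ℝ := sInf {η : ℝ | 0 < η ∧ D η ≤ n * η ^ 2 / 24}

/-- `δ_n = (η_n / (2A))^{1/α}`. -/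
def deltaN (D : ℝ → ℝ) (A α : ℝ) (n : ℕ) : ℝ := (etaN D n / (2 * A)) ^ (1 / α)

/-- `β_n = (1/2) [K η_n + 2 √(18.6 (k+1) / n)]`. -/
def betaN (D : ℝ → ℝ) (k n : ℕ) (K : ℝ) : ℝ :=
  1 / 2 * (K * etaN D n + 2 * √(18.6 * (k + 1) / n))

/-- `Λ_n = exp [(K² - 1) n η_n² / (48 (k+1)) + log log (1 + δ_n)]`. -/
def LambdaN (D : ℝ → ℝ) (A α : ℝ) (k n : ℕ) (K : ℝ) : ℝ :=
  Real.exp ((K ^ 2 - 1) * n * etaN D n ^ 2 / (48 * (k + 1))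
    + Real.log (Real.log (1 + deltaN D A α n)))

theorem deltaN_nonneg (D : ℝ → ℝ) {A : ℝ} (hA : 0 < A) (α : ℝ) (n : ℕ) : 0 ≤ deltaN D A α n :=
  Real.rpow_nonneg (div_nonneg (Real.sInf_nonneg fun _ h => h.1.le) (by positivity)) _

/-- The elements `P_{(p,m,σ)}` of the model with `|log σ| ∨ |m/σ|_∞ ≤ Λ`. -/
def restrictedModel (M₀ : Set ((Fin k → ℝ) → ℝ)) (Λ : ℝ) : Set (Model M₀) :=
  {P | ∃ p ∈ M₀, ∃ (m : Fin k → ℝ) (σ : ℝ), 0 < σ ∧ P.1 = locScale p m σ ∧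
    max |Real.log σ| ‖σ⁻¹ • m‖ ≤ Λ}

/-! ### The prior -/

/-- For `θ = (p, j₀, j)`, the distribution `P_θ` with density parameter `p`, location
`(1+δ)^{j₀} δ j` and scale `(1+δ)^{j₀}`. -/
def gridPoint {M₀ : Set ((Fin k → ℝ) → ℝ)} {N : Finset M₀} {δ : ℝ} (hδ : 0 ≤ δ)
    (θ : N × ℤ × (Fin k → ℤ)) : Model M₀ :=
  ⟨locScale θ.1.1.1 (fun i => (1 + δ) ^ θ.2.1 * δ * (θ.2.2 i : ℝ)) ((1 + δ) ^ θ.2.1),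
    θ.1.1.1, θ.1.1.2, _, _, zpow_pos (by linarith) _, rfl⟩

/-- `L_θ = (k+1) L + log |N| + 2 ∑_{i=0}^k log (1 + |j_i|)` with `L = log (π²/3 - 1)`. -/
def gridWeight {M₀ : Set ((Fin k → ℝ) → ℝ)} {N : Finset M₀} (θ : N × ℤ × (Fin k → ℤ)) : ℝ :=
  (k + 1) * Real.log (Real.pi ^ 2 / 3 - 1) + Real.log N.card
    + 2 * (Real.log (1 + |(θ.2.1 : ℝ)|) + ∑ i, Real.log (1 + |(θ.2.2 i : ℝ)|))

/-- The prior that puts the mass `exp (-L_θ)` at `P_θ`, for every `θ` in the grid. -/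
def gridPrior {M₀ : Set ((Fin k → ℝ) → ℝ)} (N : Finset M₀) {δ : ℝ} (hδ : 0 ≤ δ) :
    Measure (Model M₀) :=
  Measure.sum fun θ : N × ℤ × (Fin k → ℤ) =>
    ENNReal.ofReal (Real.exp (-gridWeight θ)) • Measure.dirac (gridPoint hδ θ)

/-- The posterior distribution built from the prior on the grid of parameters `η_n`, `δ_n`, the
functions `t_{(P,Q)}` of the total variation loss, `β = β_n` and `lam = 4 β_n / 3`. -/
def gridPosterior {M₀ : Set ((Fin k → ℝ) → ℝ)} {D : ℝ → ℝ} {net : ℝ → Finset M₀} {A α : ℝ}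
    (h : EntropyAssumption M₀ D net A α) (dens : Model M₀ → (Fin k → ℝ) → ℝ) (K : ℝ) {n : ℕ}
    (x : Fin n → Fin k → ℝ) : Measure (Model M₀) :=
  posterior (gridPrior (net (etaN D n)) (deltaN_nonneg D h.A_pos α n)) (tvTest dens)
    (4 * betaN D k n K / 3) (betaN D k n K) x

/-- `r_n = inf_{P ∈ 𝓜_n(K)} ‖S - P‖ + K η_n + √((k+1)/n) + ξ/√n`. -/
def radius (M₀ : Set ((Fin k → ℝ) → ℝ)) (D : ℝ → ℝ) (A α : ℝ) (n : ℕ) (K ξ : ℝ)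
    (S : Measure (Fin k → ℝ)) : ℝ :=
  (⨅ P : restrictedModel M₀ (LambdaN D A α k n K), tvDist S P.1.1)
    + K * etaN D n + √((k + 1) / n) + ξ / √n

end LocationScale

end

namespace LocationScale

/-! Fix a grid point `P₀` of prior mass at least `exp (-L)`. The test statistic `T(X, P₀, Q)` has
mean at most n(3/2 ‖P̄ - P₀‖ - 1/2 ‖P̄ - Q‖), where P̄ is the average distribution
(`sum_integral_tvTest_le`), so it is very negative when `Q` is far from P̄ and `P₀` is close.
Hoeffding's inequality turns this into a bound on its exponential moments
(`lintegral_exp_testSum_le`).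

The posterior involves an inner Gibbs average `testMean`. Jensen's inequality, used once for the
numerator and once for the denominator, removes it: the posterior mass of a set B is at most
exp(11L/4) Z N, with Z and N prior integrals of exp(7β/3 T(x, P₀, ·)) and of exp(β T(x, P₀, ·)) over
B (`posterior_apply_le`). Z and N depend on the same data, but since the mass is also at most 1,
truncating at a level of Z replaces the product by a sum, whose expectation follows from Fubini and
the moment bounds (`lintegral_posterior_le`).

It remains to choose `P₀`. Entropy and regularity put a grid point within 2η_n of any element of the
restricted model, with weight L ≤ nβ² (`exists_gridPoint`). All error terms are then of order nβ(‖P̄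
- P₀‖ + β) + ξ, and dividing by nβ gives the radius, as β is of order Kη_n + √((k+1)/n) and at least
1/√n (`radius_bound`). -/

theorem abs_const_mul_le {T C : ℝ} (l : ℝ) (h : |T| ≤ C) : |l * T| ≤ |l| * C := by
  rw [abs_mul]; gcongr

/-- Truncation: use the product bound where `z ≤ exp u`, and `a ≤ 1` elsewhere, where Markov's `exp
(-u) * z` exceeds 1. The random factors `z` and `N` are thereby decoupled without independence or
Hölder. -/
theorem mul_le_of_mul_le_one_or {a : ℝ≥0∞} {z N : ℝ≥0∞} {u b : ℝ} (h1 : a ≤ 1)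
    (h : a ≤ ENNReal.ofReal (Real.exp b) * z * N) :
    a ≤ ENNReal.ofReal (Real.exp (-u)) * z + ENNReal.ofReal (Real.exp (b + u)) * N := by
  by_cases hz : z ≤ ENNReal.ofReal (Real.exp u)
  · refine le_add_left (h.trans ?_)
    rw [Real.exp_add, ENNReal.ofReal_mul (Real.exp_pos _).le]
    gcongr
  · refine le_add_right (h1.trans ?_)
    calc (1 : ℝ≥0∞) = ENNReal.ofReal (Real.exp (-u)) * ENNReal.ofReal (Real.exp u) := by
          rw [← ENNReal.ofReal_mul (Real.exp_pos _).le, ← Real.exp_add]; simp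
      _ ≤ _ := by gcongr; exact (not_le.1 hz).le

/-! ### Elementary properties of the test statistic -/

section TestSum

variable {E M ι : Type*} {n : ℕ} {t : M → M → E → ℝ}

theorem abs_testSum_le (hb : ∀ P Q x, |t P Q x| ≤ 1) (x : Fin n → E) (P Q : M) :
    |testSum t x P Q| ≤ n := by
  refine (Finset.abs_sum_le_sum_abs _ _).trans ((Finset.sum_le_sum fun i _ => hb P Q (x i)).trans ?_)
  simp

theorem testSum_antisymm (ha : ∀ P Q x, t P Q x = -t Q P x) (x : Fin n → E) (P Q : M) :
    testSum t x P Q = -testSum t x Q P := by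
  simp only [testSum, ← Finset.sum_neg_distrib]
  exact Finset.sum_congr rfl fun i _ => ha P Q (x i)

theorem measurable_testSum [MeasurableSpace E] (hm : ∀ P Q, Measurable (t P Q)) (P Q : M) :
    Measurable fun x : Fin n → E => testSum t x P Q :=
  Finset.measurable_sum _ fun i _ => (hm P Q).comp (measurable_pi_apply i)

/-- The model is uncountable with the discrete σ-algebra, so measurability in `x` alone does not
give joint measurability. Passing to a countable index set restores it, which is what Fubini needs.
-/
theorem measurable_uncurry_comp [MeasurableSpace E] [Countable ι] [MeasurableSpace ι]
    [DiscreteMeasurableSpace ι] {g : ι → M} {F : (Fin n → E) → M → ℝ} (hF : ∀ Q, Measurable fun x => F x Q) :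
    Measurable fun y : (Fin n → E) × ι => F y.1 (g y.2) :=
  measurable_from_prod_countable_left fun i => hF (g i)

end TestSum

/-! ### Concentration of the posterior under abstract moment bounds -/

section AbstractPosterior

variable {E M ι : Type*} [MeasurableSpace M]

theorem integrable_exp_of_abs_le {π : Measure M} [IsFiniteMeasure π] {f : M → ℝ}
    (hf : Measurable f) {C : ℝ} (hC : ∀ Q, |f Q| ≤ C) :
    Integrable (fun Q => Real.exp (f Q)) π := by
  refine Integrable.of_bound (hf.exp.aestronglyMeasurable) (Real.exp C) (ae_of_all _ fun Q => ?_)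
  rw [Real.norm_eq_abs, abs_of_pos (Real.exp_pos _)]
  exact Real.exp_le_exp.2 ((le_abs_self _).trans (hC Q))

/-- Jensen's inequality for the Laplace transform of an exponentially tilted measure. -/
theorem exp_mul_integral_tilted_le {π : Measure M} [IsProbabilityMeasure π] {T : M → ℝ}
    (hT : Measurable T) {C : ℝ} (hC : ∀ Q, |T Q| ≤ C) (l s : ℝ) :
    Real.exp (s * ∫ Q, T Q ∂(π.tilted fun Q => l * T Q)) ≤
      (∫ Q, Real.exp ((l + s) * T Q) ∂π) / ∫ Q, Real.exp (l * T Q) ∂π := by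
  have hi : Integrable (fun Q => Real.exp (l * T Q)) π :=
    integrable_exp_of_abs_le (hT.const_mul l) fun Q => abs_const_mul_le l (hC Q)
  have : IsProbabilityMeasure (π.tilted fun Q => l * T Q) := isProbabilityMeasure_tilted hi
  have hTi : Integrable (fun Q => s * T Q) (π.tilted fun Q => l * T Q) :=
    Integrable.of_bound (hT.const_mul s).aestronglyMeasurable (|s| * C)
      (ae_of_all _ fun Q => abs_const_mul_le s (hC Q))
  have hJ := convexOn_exp.map_integral_le (μ := π.tilted fun Q => l * T Q)
    (f := fun Q => s * T Q) Real.continuous_exp.continuousOn isClosed_univ (by simp) hTi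
    (integrable_exp_of_abs_le (hT.const_mul s) fun Q => abs_const_mul_le s (hC Q))
  rw [integral_const_mul] at hJ
  refine hJ.trans_eq ?_
  have h := integral_exp_tilted (μ := π) (fun Q => l * T Q) (fun Q => s * T Q)
  rw [h]
  simp [add_mul]

/-- Only the atom at `P₀` is kept in the integral of a positive function. -/
theorem exp_neg_mul_exp_le_integral [MeasurableSingletonClass M] {π : Measure M}
    [IsProbabilityMeasure π] {f : M → ℝ} (hf : Measurable f) {C : ℝ} (hC : ∀ Q, |f Q| ≤ C)
    {P₀ : M} {L : ℝ} (hP₀ : Real.exp (-L) ≤ π.real {P₀}) :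
    Real.exp (-L) * Real.exp (f P₀) ≤ ∫ Q, Real.exp (f Q) ∂π := by
  have hi := integrable_exp_of_abs_le (π := π) hf hC
  calc Real.exp (-L) * Real.exp (f P₀) ≤ π.real {P₀} * Real.exp (f P₀) := by gcongr
    _ = ∫ Q in {P₀}, Real.exp (f Q) ∂π := by rw [integral_singleton]; simp
    _ ≤ ∫ Q, Real.exp (f Q) ∂π :=
      setIntegral_le_integral hi (ae_of_all _ fun _ => (Real.exp_pos _).le)

variable {n : ℕ} {t : M → M → E → ℝ} [DiscreteMeasurableSpace M] {π : Measure M} [IsProbabilityMeasure π]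

theorem abs_testMean_le (hb : ∀ P Q x, |t P Q x| ≤ 1) (lam : ℝ) (x : Fin n → E) (P : M) :
    |testMean π t lam x P| ≤ n := by
  have hi : Integrable (fun Q => Real.exp (lam * testSum t x P Q)) π :=
    integrable_exp_of_abs_le (.of_discrete) fun Q => abs_const_mul_le lam (abs_testSum_le hb x P Q)
  have : IsProbabilityMeasure (π.tilted fun Q => lam * testSum t x P Q) :=
    isProbabilityMeasure_tilted hi
  have h := norm_integral_le_of_norm_le_const (μ := π.tilted fun Q => lam * testSum t x P Q)
    (f := fun Q => testSum t x P Q) (C := n) (ae_of_all _ fun Q => abs_testSum_le hb x P Q)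
  simpa [testMean, auxPosterior] using h

/-- The posterior mass of a set is controlled by two exponential moments under the prior. -/
theorem posterior_apply_le (hb : ∀ P Q x, |t P Q x| ≤ 1) (ha : ∀ P Q x, t P Q x = -t Q P x)
    {P₀ : M} {L : ℝ} (hP₀ : Real.exp (-L) ≤ π.real {P₀}) (β : ℝ)
    (x : Fin n → E) (B : Set M) :
    posterior π t (4 * β / 3) β x B ≤
      ENNReal.ofReal (Real.exp (11 / 4 * L)) *
        (∫⁻ Q, ENNReal.ofReal (Real.exp (7 * β / 3 * testSum t x P₀ Q)) ∂π) *
        ∫⁻ Q in B, ENNReal.ofReal (Real.exp (β * testSum t x P₀ Q)) ∂π := by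
  have hmT : ∀ P, Measurable fun Q => testSum t x P Q := fun P => .of_discrete
  have hmM : Measurable fun P => testMean π t (4 * β / 3) x P := .of_discrete
  have hbT := abs_testSum_le (n := n) hb x
  have hbM := abs_testMean_le (n := n) (π := π) hb (4 * β / 3) x
  set Z := ∫ Q, Real.exp (7 * β / 3 * testSum t x P₀ Q) ∂π with hZ
  have hZi : Integrable (fun Q => Real.exp (7 * β / 3 * testSum t x P₀ Q)) π :=
    integrable_exp_of_abs_le ((hmT P₀).const_mul _) fun Q => abs_const_mul_le _ (hbT P₀ Q)
  have hZpos : 0 < Z := integral_exp_pos hZi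
  have hself : testSum t x P₀ P₀ = 0 := by
    have := testSum_antisymm ha x P₀ P₀
    linarith
  -- the denominator
  have hden : Real.exp (-(2 * L)) / Z ≤ ∫ P, Real.exp (-β * testMean π t (4 * β / 3) x P) ∂π := by
    -- Jensen with `s = β` gives exp(β T(x, P₀)) ≤ Z exp(L), because T(x, P₀, P₀) = 0. The atom at
    -- `P₀` then costs a second factor exp(-L), hence the exponent 2L.
    have h1 := exp_mul_integral_tilted_le (π := π) (hmT P₀) (hbT P₀) (4 * β / 3) β
    have h2 := exp_neg_mul_exp_le_integral (π := π) ((hmT P₀).const_mul (4 * β / 3))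
      (fun Q => abs_const_mul_le _ (hbT P₀ Q)) hP₀
    have h3 := exp_neg_mul_exp_le_integral (π := π) (hmM.const_mul (-β))
      (fun Q => abs_const_mul_le _ (hbM Q)) hP₀
    rw [hself, mul_zero, Real.exp_zero, mul_one] at h2
    rw [show 4 * β / 3 + β = 7 * β / 3 by ring, ← hZ] at h1
    have h4 : Real.exp (β * testMean π t (4 * β / 3) x P₀) ≤ Z / Real.exp (-L) :=
      h1.trans (div_le_div_of_nonneg_left hZpos.le (Real.exp_pos _) h2)
    refine le_trans ?_ h3
    rw [neg_mul, Real.exp_neg (β * _)]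
    rw [le_div_iff₀ (Real.exp_pos _)] at h4
    rw [← div_eq_mul_inv, div_le_div_iff₀ hZpos (Real.exp_pos _),
      show -(2 * L) = -L + -L by ring, Real.exp_add]
    nlinarith [Real.exp_pos (-L)]
  -- Jensen with `s = -lam` makes the tilted exponent vanish, so exp(-lam T(x, P)) ≤ exp(L + lam
  -- T(x, P₀, P)) by the atom at `P₀` and antisymmetry. The power β/lam = 3/4 of this is the claim.
  have hnum : ∀ P, Real.exp (-β * testMean π t (4 * β / 3) x P) ≤
      Real.exp (3 / 4 * L) * Real.exp (β * testSum t x P₀ P) := by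
    intro P
    have h1 := exp_mul_integral_tilted_le (π := π) (hmT P) (hbT P) (4 * β / 3) (-(4 * β / 3))
    have h2 := exp_neg_mul_exp_le_integral (π := π) ((hmT P).const_mul (4 * β / 3))
      (fun Q => abs_const_mul_le _ (hbT P Q)) hP₀
    simp only [add_neg_cancel, zero_mul, Real.exp_zero, integral_const, probReal_univ,
      smul_eq_mul, mul_one] at h1
    rw [← Real.exp_add] at h2
    have h3 := h1.trans (one_div_le_one_div_of_le (Real.exp_pos _) h2)
    rw [one_div, ← Real.exp_neg, Real.exp_le_exp, testSum_antisymm ha x P P₀] at h3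
    rw [← Real.exp_add, Real.exp_le_exp]
    change -(4 * β / 3) * testMean π t (4 * β / 3) x P ≤ _ at h3
    linarith
  have hpt : ∀ P, ENNReal.ofReal (Real.exp (-β * testMean π t (4 * β / 3) x P) /
      ∫ P, Real.exp (-β * testMean π t (4 * β / 3) x P) ∂π) ≤
      ENNReal.ofReal (Real.exp (11 / 4 * L) * Z) *
        ENNReal.ofReal (Real.exp (β * testSum t x P₀ P)) := by
    intro P
    rw [← ENNReal.ofReal_mul (by positivity)]
    apply ENNReal.ofReal_le_ofReal
    have hpos : 0 < Real.exp (-(2 * L)) / Z := by positivity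
    refine (div_le_div₀ (by positivity) (hnum P) hpos hden).trans_eq ?_
    rw [show 11 / 4 * L = 3 / 4 * L + 2 * L by ring, Real.exp_add (3 / 4 * L), Real.exp_neg]
    field_simp
  rw [posterior, tilted_apply' _ _ .of_discrete]
  calc _ ≤ ∫⁻ P in B, ENNReal.ofReal (Real.exp (11 / 4 * L) * Z) *
        ENNReal.ofReal (Real.exp (β * testSum t x P₀ P)) ∂π := lintegral_mono hpt
    _ = _ := by
      rw [lintegral_const_mul _ .of_discrete, ENNReal.ofReal_mul (Real.exp_pos _).le, hZ,
        ofReal_integral_eq_lintegral_ofReal hZi (ae_of_all _ fun _ => (Real.exp_pos _).le)]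

theorem posterior_apply_le_one (hb : ∀ P Q x, |t P Q x| ≤ 1) (lam β : ℝ) (x : Fin n → E)
    (B : Set M) : posterior π t lam β x B ≤ 1 := by
  have : IsProbabilityMeasure (posterior π t lam β x) :=
    isProbabilityMeasure_tilted (integrable_exp_of_abs_le .of_discrete fun Q =>
      abs_const_mul_le (-β) (abs_testMean_le hb lam x Q))
  exact prob_le_one

variable [MeasurableSpace E] [Countable ι] [MeasurableSpace ι] [DiscreteMeasurableSpace ι]
  {ρ : Measure ι} {g : ι → M}

theorem measurable_integral_of_countable [SFinite ρ] {F : (Fin n → E) → M → ℝ}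
    (hF : ∀ Q, Measurable fun x => F x Q) :
    Measurable fun x => ∫ Q, F x Q ∂(ρ.map g) := by
  have h : ∀ x, ∫ Q, F x Q ∂(ρ.map g) = ∫ i, F x (g i) ∂ρ := fun x =>
    integral_map .of_discrete (Measurable.of_discrete.aestronglyMeasurable)
  simp only [h]
  exact (StronglyMeasurable.integral_prod_right
    (measurable_uncurry_comp (g := g) hF).stronglyMeasurable).measurable

theorem measurable_testMean [SFinite ρ] (hm : ∀ P Q, Measurable (t P Q)) (lam : ℝ) (P : M) :
    Measurable fun x : Fin n → E => testMean (ρ.map g) t lam x P := by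
  simp only [testMean, auxPosterior, integral_tilted]
  refine measurable_integral_of_countable fun Q => ?_
  exact (((measurable_testSum hm P Q).const_mul lam).exp.div
    (measurable_integral_of_countable fun Q =>
      ((measurable_testSum hm P Q).const_mul lam).exp)).smul (measurable_testSum hm P Q)

theorem measurable_posterior_apply [SFinite ρ] (hm : ∀ P Q, Measurable (t P Q)) (lam β : ℝ)
    (B : Set M) : Measurable fun x : Fin n → E => posterior (ρ.map g) t lam β x B := by
  simp only [posterior, tilted_apply' _ _ (MeasurableSet.of_discrete (s := B))]
  have h : ∀ (F : M → ℝ≥0∞), ∫⁻ Q in B, F Q ∂(ρ.map g) = ∫⁻ i in g ⁻¹' B, F (g i) ∂ρ := fun F =>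
    setLIntegral_map .of_discrete .of_discrete .of_discrete
  simp only [h]
  have hnum : ∀ Q, Measurable fun x : Fin n → E =>
      Real.exp (-β * testMean (ρ.map g) t lam x Q) := fun Q =>
    ((measurable_testMean hm lam Q).const_mul (-β)).exp
  exact Measurable.lintegral_prod_right (ν := ρ.restrict (g ⁻¹' B))
    ((measurable_uncurry_comp (g := g) hnum).div
      ((measurable_integral_of_countable hnum).comp measurable_fst)).ennreal_ofReal

/-- The posterior concentrates on the set `{r ≤ R}`. -/
theorem lintegral_posterior_le [SFinite ρ] [IsProbabilityMeasure (ρ.map g)]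
    (hm : ∀ P Q, Measurable (t P Q)) (hb : ∀ P Q x, |t P Q x| ≤ 1)
    (ha : ∀ P Q x, t P Q x = -t Q P x) {μ : Measure (Fin n → E)} [IsProbabilityMeasure μ]
    {P₀ : M} {L : ℝ} (hP₀ : Real.exp (-L) ≤ (ρ.map g).real {P₀}) {r : M → ℝ} (hr : ∀ Q, 0 ≤ r Q)
    (hexp : ∀ u, 0 ≤ u → ∀ Q, ∫⁻ x, ENNReal.ofReal (Real.exp (u * testSum t x P₀ Q)) ∂μ ≤
      ENNReal.ofReal (Real.exp (n * (u * (3 / 2 * r P₀ - 1 / 2 * r Q) + u ^ 2 / 8))))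
    {β : ℝ} (hβ : 0 < β) {ξ R : ℝ}
    (hR : 11 / 4 * L + 5 * (n * β * r P₀) + 29 / 36 * (n * β ^ 2) + 2 * ξ ≤ n * β * R / 2) :
    ∫⁻ x, posterior (ρ.map g) t (4 * β / 3) β x {Q | r Q ≤ R}ᶜ ∂μ ≤
      ENNReal.ofReal (2 * Real.exp (-ξ)) := by
  set B : Set M := {Q | r Q ≤ R}ᶜ with hB
  -- `a` is the exponent of the moment bound at u = 7β/3 with the favourable term in `r Q` dropped.
  -- Truncating Z at exp(a + ξ) makes each of the two final terms contribute exp(-ξ).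
  set a : ℝ := 7 / 2 * (n * β * r P₀) + 49 / 72 * (n * β ^ 2) with ha'
  have hmeas : ∀ u : ℝ, Measurable fun y : (Fin n → E) × ι =>
      ENNReal.ofReal (Real.exp (u * testSum t y.1 P₀ (g y.2))) := fun u =>
    (measurable_uncurry_comp (g := g) (F := fun x Q => Real.exp (u * testSum t x P₀ Q)) fun Q =>
      ((measurable_testSum hm P₀ Q).const_mul u).exp).ennreal_ofReal
  have hswap : ∀ (u c : ℝ) (A : Set M), (∀ Q ∈ A,
      ∫⁻ x, ENNReal.ofReal (Real.exp (u * testSum t x P₀ Q)) ∂μ ≤ ENNReal.ofReal (Real.exp c)) →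
      ∫⁻ x, ∫⁻ Q in A, ENNReal.ofReal (Real.exp (u * testSum t x P₀ Q)) ∂(ρ.map g) ∂μ ≤
        ENNReal.ofReal (Real.exp c) := by
    intro u c A h
    simp only [setLIntegral_map (MeasurableSet.of_discrete (s := A)) (Measurable.of_discrete)
      (Measurable.of_discrete (f := g))]
    rw [lintegral_lintegral_swap (hmeas u).aemeasurable]
    calc _ ≤ ∫⁻ _ in g ⁻¹' A, ENNReal.ofReal (Real.exp c) ∂ρ :=
          setLIntegral_mono' .of_discrete fun i hi => h (g i) hi
      _ = ENNReal.ofReal (Real.exp c) * (ρ.map g) A := by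
          rw [setLIntegral_const, Measure.map_apply .of_discrete .of_discrete]
      _ ≤ ENNReal.ofReal (Real.exp c) * 1 := by gcongr; exact prob_le_one
      _ = _ := mul_one _
  have hZ : ∫⁻ x, ∫⁻ Q, ENNReal.ofReal (Real.exp (7 * β / 3 * testSum t x P₀ Q)) ∂(ρ.map g) ∂μ ≤
      ENNReal.ofReal (Real.exp a) := by
    have := hswap (7 * β / 3) a univ fun Q _ => (hexp _ (by positivity) Q).trans <| by
      refine ENNReal.ofReal_le_ofReal (Real.exp_le_exp.2 ?_)
      have : 0 ≤ n * β * r Q := mul_nonneg (by positivity) (hr Q)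
      rw [ha']
      linarith
    simpa using this
  -- On `B` one has `R < r Q`. Adding `a` to the exponent at u = β produces the constants of `hR`:
  -- 7/2 + 3/2 = 5 and 49/72 + 1/8 = 29/36.
  have hN : ∫⁻ x, ∫⁻ Q in B, ENNReal.ofReal (Real.exp (β * testSum t x P₀ Q)) ∂(ρ.map g) ∂μ ≤
      ENNReal.ofReal (Real.exp (-ξ - (11 / 4 * L + (a + ξ)))) := by
    refine hswap β _ B fun Q hQ => (hexp _ hβ.le Q).trans ?_
    refine ENNReal.ofReal_le_ofReal (Real.exp_le_exp.2 ?_)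
    have hQ' : R < r Q := by simpa [hB] using hQ
    have : n * β * R ≤ n * β * r Q := by gcongr
    rw [ha']
    linarith
  have hmZ : Measurable fun x : Fin n → E => ∫⁻ Q, ENNReal.ofReal
      (Real.exp (7 * β / 3 * testSum t x P₀ Q)) ∂(ρ.map g) := by
    simp only [lintegral_map (Measurable.of_discrete) (Measurable.of_discrete (f := g))]
    exact Measurable.lintegral_prod_right (hmeas _)
  have hmN : Measurable fun x : Fin n → E => ∫⁻ Q in B, ENNReal.ofReal
      (Real.exp (β * testSum t x P₀ Q)) ∂(ρ.map g) := by
    simp only [setLIntegral_map (MeasurableSet.of_discrete (s := B)) (Measurable.of_discrete)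
      (Measurable.of_discrete (f := g))]
    exact Measurable.lintegral_prod_right (ν := ρ.restrict _) (hmeas _)
  calc _ ≤ ∫⁻ x, (ENNReal.ofReal (Real.exp (-(a + ξ))) *
          (∫⁻ Q, ENNReal.ofReal (Real.exp (7 * β / 3 * testSum t x P₀ Q)) ∂(ρ.map g)) +
        ENNReal.ofReal (Real.exp (11 / 4 * L + (a + ξ))) *
          ∫⁻ Q in B, ENNReal.ofReal (Real.exp (β * testSum t x P₀ Q)) ∂(ρ.map g)) ∂μ :=
        lintegral_mono fun x => mul_le_of_mul_le_one_or (posterior_apply_le_one hb _ _ x B)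
          (posterior_apply_le hb ha hP₀ β x B)
    _ ≤ ENNReal.ofReal (Real.exp (-(a + ξ))) * ENNReal.ofReal (Real.exp a) +
        ENNReal.ofReal (Real.exp (11 / 4 * L + (a + ξ))) *
          ENNReal.ofReal (Real.exp (-ξ - (11 / 4 * L + (a + ξ)))) := by
        rw [lintegral_add_left (hmZ.const_mul _), lintegral_const_mul _ hmZ,
          lintegral_const_mul _ hmN]
        gcongr
    _ = _ := by
        rw [← ENNReal.ofReal_mul (Real.exp_pos _).le, ← ENNReal.ofReal_mul (Real.exp_pos _).le,
          ← Real.exp_add, ← Real.exp_add, ← ENNReal.ofReal_add (Real.exp_pos _).le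
          (Real.exp_pos _).le]
        ring_nf

end AbstractPosterior

/-! ### Total variation distance -/

section TotalVariation

variable {E F : Type*} [MeasurableSpace E] [MeasurableSpace F] {P Q R : Measure E}

theorem tvDist_le {r : ℝ} (h : ∀ S, MeasurableSet S → |P.real S - Q.real S| ≤ r) :
    tvDist P Q ≤ r :=
  have : Nonempty {S : Set E // MeasurableSet S} := ⟨⟨∅, .empty⟩⟩
  ciSup_le fun S => h S.1 S.2

theorem tvDist_nonneg : 0 ≤ tvDist P Q := Real.iSup_nonneg fun _ => abs_nonneg _

variable [IsProbabilityMeasure P] [IsProbabilityMeasure Q]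

theorem abs_real_sub_real_le_tvDist {S : Set E} (hS : MeasurableSet S) :
    |P.real S - Q.real S| ≤ tvDist P Q := by
  refine le_ciSup (f := fun S : {S : Set E // MeasurableSet S} => |P.real S.1 - Q.real S.1|)
    ⟨1, ?_⟩ ⟨S, hS⟩
  rintro _ ⟨T, rfl⟩
  have h1 : P.real T.1 ≤ 1 := measureReal_le_one
  have h2 : Q.real T.1 ≤ 1 := measureReal_le_one
  exact abs_sub_le_iff.2 ⟨by linarith [measureReal_nonneg (μ := Q) (s := T.1)],
    by linarith [measureReal_nonneg (μ := P) (s := T.1)]⟩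

theorem tvDist_triangle [IsProbabilityMeasure R] : tvDist P R ≤ tvDist P Q + tvDist Q R :=
  tvDist_le fun _ hS => (abs_sub_le _ (Q.real _) _).trans
    (add_le_add (abs_real_sub_real_le_tvDist hS) (abs_real_sub_real_le_tvDist hS))

theorem tvDist_map_le {f : E → F} (hf : Measurable f) : tvDist (P.map f) (Q.map f) ≤ tvDist P Q :=
  tvDist_le fun S hS => by
    rw [map_measureReal_apply hf hS, map_measureReal_apply hf hS]
    exact abs_real_sub_real_le_tvDist (hf hS)

end TotalVariation

/-! ### Averages and Hoeffding's inequality for non-identical distributions -/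

section Average

variable {E : Type*} [MeasurableSpace E] {n : ℕ} {P : Fin n → Measure E}
  [∀ i, IsProbabilityMeasure (P i)]

theorem isProbabilityMeasure_average (hn : 0 < n) : IsProbabilityMeasure (average P) :=
  ⟨by
    have : (n : ℝ≥0∞) ≠ 0 := by exact_mod_cast hn.ne'
    simp [average, ENNReal.inv_mul_cancel this]⟩

theorem sum_real_eq (hn : 0 < n) (S : Set E) : ∑ i, (P i).real S = n * (average P).real S := by
  have : (n : ℝ) ≠ 0 := by exact_mod_cast hn.ne'
  rw [average, measureReal_ennreal_smul_apply, measureReal_def, Measure.finsetSum_apply,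
    ENNReal.toReal_sum fun i _ => measure_ne_top _ _]
  simp [measureReal_def, this]

/-- Hoeffding's inequality for the Laplace transform of a sum of independent variables. -/
theorem lintegral_exp_sum_le {t : E → ℝ} (ht : Measurable t) {c : ℝ}
    (hc : ∀ x, t x ∈ Icc (c - 1 / 2) (c + 1 / 2)) (u : ℝ) :
    ∫⁻ x, ENNReal.ofReal (Real.exp (u * ∑ i, t (x i))) ∂(Measure.pi P) ≤
      ENNReal.ofReal (Real.exp (u * ∑ i, ∫ y, t y ∂(P i) + n * u ^ 2 / 8)) := by
  have hfac : ∀ x : Fin n → E, Real.exp (u * ∑ i, t (x i)) = ∏ i, Real.exp (u * t (x i)) :=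
    fun x => by rw [Finset.mul_sum, Real.exp_sum]
  have hone : ∀ i, ∫ y, Real.exp (u * t y) ∂(P i) ≤
      Real.exp (u * ∫ y, t y ∂(P i) + u ^ 2 / 8) := by
    intro i
    have h := (ProbabilityTheory.hasSubgaussianMGF_of_mem_Icc (μ := P i) ht.aemeasurable
      (ae_of_all _ hc)).mgf_le u
    have hs : (fun y => Real.exp (u * (t y - ∫ z, t z ∂(P i)))) =
        fun y => Real.exp (-(u * ∫ z, t z ∂(P i))) * Real.exp (u * t y) := by
      ext y; rw [← Real.exp_add]; ring_nf
    rw [ProbabilityTheory.mgf, hs, integral_const_mul, Real.exp_neg,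
      inv_mul_le_iff₀ (Real.exp_pos _), ← Real.exp_add] at h
    refine h.trans_eq (congrArg _ ?_)
    -- The range has length 1, so the sub-Gaussian variance proxy is 1/4, whence u²/8.
    have : c + 1 / 2 - (c - 1 / 2) = 1 := by ring
    simp only [this, nnnorm_one]
    push_cast
    ring
  have hint : Integrable (fun x : Fin n → E => ∏ i, Real.exp (u * t (x i))) (Measure.pi P) := by
    refine Integrable.fintype_prod (f := fun _ y => Real.exp (u * t y)) fun i => ?_
    refine integrable_exp_of_abs_le (ht.const_mul u) fun y =>
      abs_const_mul_le (C := |c| + 1 / 2) u (abs_le.2 ⟨?_, ?_⟩)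
    · linarith [(hc y).1, neg_abs_le c]
    · linarith [(hc y).2, le_abs_self c]
  simp only [hfac]
  rw [← ofReal_integral_eq_lintegral_ofReal hint
    (ae_of_all _ fun x => Finset.prod_nonneg fun i _ => (Real.exp_pos _).le),
    integral_fintype_prod_eq_prod (fun _ y => Real.exp (u * t y))]
  refine ENNReal.ofReal_le_ofReal ((Finset.prod_le_prod
    (fun i _ => integral_nonneg fun _ => (Real.exp_pos _).le) fun i _ => hone i).trans_eq ?_)
  rw [← Real.exp_sum, Finset.sum_add_distrib, ← Finset.mul_sum]
  simp
  ring

end Average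

/-! ### Total variation between densities -/

section Density

variable {k : ℕ} {p q : (Fin k → ℝ) → ℝ}

theorem IsDensity.isProbabilityMeasure (hp : IsDensity p) :
    IsProbabilityMeasure (densityMeasure p) :=
  ⟨by rw [densityMeasure, withDensity_apply _ .univ, setLIntegral_univ, hp.lintegral_eq_one]⟩

theorem densityMeasure_le_of_subset (hp : IsDensity p) (hq : IsDensity q) {S : Set (Fin k → ℝ)}
    (hS : MeasurableSet S) (h : ∀ x ∈ S, p x ≤ q x) :
    (densityMeasure p).real S ≤ (densityMeasure q).real S := by
  have := hp.isProbabilityMeasure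
  have := hq.isProbabilityMeasure
  refine ENNReal.toReal_mono (measure_ne_top _ _) ?_
  rw [densityMeasure, densityMeasure, withDensity_apply _ hS, withDensity_apply _ hS]
  exact setLIntegral_mono' hS fun x hx => ENNReal.ofReal_le_ofReal (h x hx)

/-- The total variation distance is attained at `{p < q}`. -/
theorem tvDist_densityMeasure_le (hp : IsDensity p) (hq : IsDensity q) :
    tvDist (densityMeasure p) (densityMeasure q) ≤
      (densityMeasure q).real {x | p x < q x} - (densityMeasure p).real {x | p x < q x} := by
  have := hp.isProbabilityMeasure
  have := hq.isProbabilityMeasure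
  have hA : MeasurableSet {x | p x < q x} := measurableSet_lt hp.measurable hq.measurable
  set A := {x | p x < q x}
  -- Passing from `S` to `A` removes points where `q ≤ p` and adds points where `p < q`; both
  -- changes increase the difference.
  have key : ∀ S, MeasurableSet S → (densityMeasure q).real S - (densityMeasure p).real S ≤
      (densityMeasure q).real A - (densityMeasure p).real A := by
    intro S hS
    have h1 := densityMeasure_le_of_subset hq hp (hS.diff hA) fun x hx => not_lt.1 hx.2
    have h2 := densityMeasure_le_of_subset hp hq (hA.diff hS) fun x hx => hx.1.le
    have h3 := measureReal_inter_add_sdiff (μ := densityMeasure p) (s := S) hA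
    have h4 := measureReal_inter_add_sdiff (μ := densityMeasure q) (s := S) hA
    have h5 := measureReal_inter_add_sdiff (μ := densityMeasure p) (s := A) hS
    have h6 := measureReal_inter_add_sdiff (μ := densityMeasure q) (s := A) hS
    rw [inter_comm] at h5 h6
    linarith
  refine tvDist_le fun S hS => abs_sub_le_iff.2 ⟨?_, key S hS⟩
  -- For probability measures, complementation reverses the sign of the difference.
  have := key Sᶜ hS.compl
  rw [probReal_compl_eq_one_sub hS, probReal_compl_eq_one_sub hS] at this
  linarith

end Density

/-! ### The test functions for the total variation loss -/

section Test

variable {k : ℕ} {M₀ : Set ((Fin k → ℝ) → ℝ)} {dens : Model M₀ → (Fin k → ℝ) → ℝ}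

theorem IsDensityChoice.isProbabilityMeasure (hd : IsDensityChoice dens) (P : Model M₀) :
    IsProbabilityMeasure P.1 := by
  rw [(hd P).2]; exact (hd P).1.isProbabilityMeasure

theorem IsDensityChoice.measurableSet_lt (hd : IsDensityChoice dens) (P Q : Model M₀) :
    MeasurableSet {y | dens P y < dens Q y} :=
  _root_.measurableSet_lt (hd P).1.measurable (hd Q).1.measurable

theorem tvTest_antisymm (P Q : Model M₀) (x : Fin k → ℝ) :
    tvTest dens P Q x = -tvTest dens Q P x := by
  simp only [tvTest]; ring

theorem tvTest_eq (P Q : Model M₀) (x : Fin k → ℝ) : tvTest dens P Q x =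
    1 / 2 * {y | dens P y < dens Q y}.indicator 1 x - 1 / 2 * {y | dens Q y < dens P y}.indicator 1 x
      + (1 / 2 * P.1.real {y | dens Q y < dens P y} -
        1 / 2 * Q.1.real {y | dens P y < dens Q y}) := by
  simp only [tvTest, indicator_apply, mem_ofPred_eq, Pi.one_apply]
  ring

theorem IsDensityChoice.measurable_tvTest (hd : IsDensityChoice dens) (P Q : Model M₀) :
    Measurable (tvTest dens P Q) := by
  simp only [funext (tvTest_eq (dens := dens) P Q)]
  exact (((measurable_one.indicator (hd.measurableSet_lt P Q)).const_mul _).sub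
    ((measurable_one.indicator (hd.measurableSet_lt Q P)).const_mul _)).add_const _

theorem tvTest_mem_Icc (P Q : Model M₀) (x : Fin k → ℝ) :
    tvTest dens P Q x ∈
      Icc (1 / 2 * P.1.real {y | dens Q y < dens P y} -
        1 / 2 * Q.1.real {y | dens P y < dens Q y} - 1 / 2)
        (1 / 2 * P.1.real {y | dens Q y < dens P y} -
        1 / 2 * Q.1.real {y | dens P y < dens Q y} + 1 / 2) := by
  simp only [tvTest]
  constructor <;> split_ifs <;> linarith

theorem IsDensityChoice.abs_tvTest_le (hd : IsDensityChoice dens) (P Q : Model M₀)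
    (x : Fin k → ℝ) : |tvTest dens P Q x| ≤ 1 := by
  have := hd.isProbabilityMeasure P
  have := hd.isProbabilityMeasure Q
  have h1 := tvTest_mem_Icc (dens := dens) P Q x
  have h2 : P.1.real {y | dens Q y < dens P y} ≤ 1 := measureReal_le_one
  have h3 : Q.1.real {y | dens P y < dens Q y} ≤ 1 := measureReal_le_one
  have h4 : 0 ≤ P.1.real {y | dens Q y < dens P y} := measureReal_nonneg
  have h5 : 0 ≤ Q.1.real {y | dens P y < dens Q y} := measureReal_nonneg
  exact abs_le.2 ⟨by linarith [h1.1], by linarith [h1.2]⟩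

theorem IsDensityChoice.integral_tvTest (hd : IsDensityChoice dens) (P Q : Model M₀)
    (S : Measure (Fin k → ℝ)) [IsProbabilityMeasure S] : ∫ x, tvTest dens P Q x ∂S =
    1 / 2 * S.real {y | dens P y < dens Q y} - 1 / 2 * S.real {y | dens Q y < dens P y}
      + (1 / 2 * P.1.real {y | dens Q y < dens P y} -
        1 / 2 * Q.1.real {y | dens P y < dens Q y}) := by
  have hi : ∀ P Q : Model M₀, Integrable
      (fun x => 1 / 2 * {y | dens P y < dens Q y}.indicator (1 : (Fin k → ℝ) → ℝ) x) S := fun P Q =>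
    ((integrable_const (1 : ℝ)).indicator (hd.measurableSet_lt P Q)).const_mul _
  have hs : Integrable (fun x =>
      1 / 2 * {y | dens P y < dens Q y}.indicator (1 : (Fin k → ℝ) → ℝ) x -
        1 / 2 * {y | dens Q y < dens P y}.indicator (1 : (Fin k → ℝ) → ℝ) x) S :=
    (hi P Q).sub (hi Q P)
  simp only [tvTest_eq]
  rw [integral_add hs (integrable_const _), integral_sub (hi P Q) (hi Q P),
    integral_const_mul, integral_const_mul, integral_indicator_one (hd.measurableSet_lt P Q),
    integral_indicator_one (hd.measurableSet_lt Q P)]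
  simp

variable {n : ℕ} {P : Fin n → Measure (Fin k → ℝ)} [∀ i, IsProbabilityMeasure (P i)]

/-- If the data had law `P₀`, the mean of each test would be at most -1/2 ‖P₀ - Q‖. Replacing `P₀`
by the average changes the probabilities of the two sets, each with weight 1/2, at a total cost of
‖P̄ - P₀‖; the triangle inequality through `P₀` costs another half of it. -/
theorem IsDensityChoice.sum_integral_tvTest_le (hd : IsDensityChoice dens) (hn : 0 < n)
    (P₀ Q : Model M₀) : ∑ i, ∫ x, tvTest dens P₀ Q x ∂(P i) ≤
      n * (3 / 2 * tvDist (average P) P₀.1 - 1 / 2 * tvDist (average P) Q.1) := by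
  have := hd.isProbabilityMeasure P₀
  have := hd.isProbabilityMeasure Q
  have := isProbabilityMeasure_average (P := P) hn
  have hA := hd.measurableSet_lt P₀ Q
  have hB := hd.measurableSet_lt Q P₀
  simp only [hd.integral_tvTest, Finset.sum_add_distrib, Finset.sum_sub_distrib,
    ← Finset.mul_sum, sum_real_eq (P := P) hn, Finset.sum_const, Finset.card_univ, Fintype.card_fin,
    nsmul_eq_mul]
  have h1 := (abs_le.1 (abs_real_sub_real_le_tvDist (P := average P) (Q := P₀.1) hA)).2
  have h2 := (abs_le.1 (abs_real_sub_real_le_tvDist (P := average P) (Q := P₀.1) hB)).1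
  have h3 : tvDist P₀.1 Q.1 ≤ Q.1.real {y | dens P₀ y < dens Q y} -
      P₀.1.real {y | dens P₀ y < dens Q y} := by
    have := tvDist_densityMeasure_le (hd P₀).1 (hd Q).1
    rwa [← (hd P₀).2, ← (hd Q).2] at this
  have h4 := tvDist_triangle (P := average P) (Q := P₀.1) (R := Q.1)
  have hn' : (0 : ℝ) < n := by exact_mod_cast hn
  have h5 := mul_le_mul_of_nonneg_left (a := (n : ℝ)) (c := 3 / 2 * tvDist (average P) P₀.1 -
    1 / 2 * tvDist (average P) Q.1) (b := 1 / 2 * (average P).real {y | dens P₀ y < dens Q y} -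
    1 / 2 * (average P).real {y | dens Q y < dens P₀ y} +
    (1 / 2 * P₀.1.real {y | dens Q y < dens P₀ y} - 1 / 2 * Q.1.real {y | dens P₀ y < dens Q y}))
    (by linarith) hn'.le
  linarith

theorem IsDensityChoice.lintegral_exp_testSum_le (hd : IsDensityChoice dens) (hn : 0 < n)
    (P₀ Q : Model M₀) {u : ℝ} (hu : 0 ≤ u) :
    ∫⁻ x, ENNReal.ofReal (Real.exp (u * testSum (tvTest dens) x P₀ Q)) ∂(Measure.pi P) ≤
      ENNReal.ofReal (Real.exp (n * (u * (3 / 2 * tvDist (average P) P₀.1 -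
        1 / 2 * tvDist (average P) Q.1) + u ^ 2 / 8))) := by
  refine (lintegral_exp_sum_le (hd.measurable_tvTest P₀ Q) (tvTest_mem_Icc P₀ Q) u).trans
    (ENNReal.ofReal_le_ofReal (Real.exp_le_exp.2 ?_))
  have := mul_le_mul_of_nonneg_left (hd.sum_integral_tvTest_le (P := P) hn P₀ Q) hu
  linarith

end Test

/-! ### Affine equivariance of the location-scale family -/

section Affine

variable {k : ℕ} {p q : (Fin k → ℝ) → ℝ}

theorem volume_map_affine (m : Fin k → ℝ) {σ : ℝ} (hσ : 0 < σ) :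
    (volume : Measure (Fin k → ℝ)).map (fun x => σ • x + m) =
      ENNReal.ofReal (σ ^ k)⁻¹ • volume := by
  have h : (fun x : Fin k → ℝ => σ • x + m) = (fun x => x + m) ∘ fun x => σ • x := rfl
  rw [h, ← Measure.map_map (measurable_add_const m) (measurable_const_smul σ),
    Measure.map_addHaar_smul _ hσ.ne', Measure.map_smul, map_add_right_eq_self,
    abs_of_pos (by positivity)]
  simp

theorem map_affine_densityMeasure (hp : Measurable p) (m : Fin k → ℝ) {σ : ℝ} (hσ : 0 < σ) :
    (densityMeasure p).map (fun x => σ • x + m) = locScale p m σ := by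
  have hf : Measurable fun x : Fin k → ℝ => σ • x + m := by fun_prop
  have hg : Measurable fun x : Fin k → ℝ => ENNReal.ofReal (p (σ⁻¹ • (x - m))) := by fun_prop
  ext S hS
  rw [Measure.map_apply hf hS, locScale, densityMeasure, densityMeasure,
    withDensity_apply _ (hf hS), withDensity_apply _ hS]
  simp only [ENNReal.ofReal_mul (show 0 ≤ (σ ^ k)⁻¹ by positivity)]
  rw [lintegral_const_mul _ hg, ← smul_eq_mul, ← lintegral_smul_measure, ← Measure.restrict_smul,
    ← volume_map_affine m hσ, setLIntegral_map hS hg hf]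
  simp [hσ.ne']

theorem locScale_zero_one : locScale p 0 1 = densityMeasure p := by
  simp [locScale]

theorem map_affine_locScale (hp : Measurable p) (m m' : Fin k → ℝ) {σ : ℝ} (hσ : 0 < σ) (σ' : ℝ) :
    (locScale p m' σ').map (fun x => σ • x + m) = locScale p (σ • m' + m) (σ * σ') := by
  rw [locScale, map_affine_densityMeasure (by fun_prop) m hσ]
  unfold locScale
  congr 1
  ext x
  have : (σ * σ')⁻¹ • (x - (σ • m' + m)) = σ'⁻¹ • (σ⁻¹ • (x - m) - m') := by
    ext i
    simp
    field_simp
    ring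
  rw [this, mul_pow, mul_inv, mul_assoc]

theorem IsDensity.isProbabilityMeasure_locScale (hp : IsDensity p) (m : Fin k → ℝ) {σ : ℝ}
    (hσ : 0 < σ) : IsProbabilityMeasure (locScale p m σ) := by
  have := hp.isProbabilityMeasure
  rw [← map_affine_densityMeasure hp.measurable m hσ]
  exact Measure.isProbabilityMeasure_map (by fun_prop)

theorem tvDist_locScale_le (hp : IsDensity p) (hq : IsDensity q) (m : Fin k → ℝ) {σ : ℝ}
    (hσ : 0 < σ) :
    tvDist (locScale p m σ) (locScale q m σ) ≤ tvDist (locScale p 0 1) (locScale q 0 1) := by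
  have := hp.isProbabilityMeasure
  have := hq.isProbabilityMeasure
  rw [← map_affine_densityMeasure hp.measurable m hσ, ← map_affine_densityMeasure hq.measurable m hσ,
    locScale_zero_one, locScale_zero_one]
  exact tvDist_map_le (by fun_prop)

/-- Both measures are images, under x ↦ σx + m, of the standardized pair, and a pushforward does not
increase total variation. This brings the pair to the form in which regularity is assumed. -/
theorem tvDist_locScale_le_standardized (hp : IsDensity p) (m m' : Fin k → ℝ) {σ σ' : ℝ}
    (hσ : 0 < σ) (hσ' : 0 < σ') :
    tvDist (locScale p m σ) (locScale p m' σ') ≤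
      tvDist (locScale p 0 1) (locScale p (σ⁻¹ • (m' - m)) (σ' / σ)) := by
  have := hp.isProbabilityMeasure_locScale 0 one_pos
  have := hp.isProbabilityMeasure_locScale (σ⁻¹ • (m' - m)) (div_pos hσ' hσ)
  have h1 := map_affine_locScale hp.measurable m 0 hσ 1
  have h2 := map_affine_locScale hp.measurable m (σ⁻¹ • (m' - m)) hσ (σ' / σ)
  rw [smul_zero, zero_add, mul_one] at h1
  rw [smul_inv_smul₀ hσ.ne', sub_add_cancel, mul_div_cancel₀ _ hσ.ne'] at h2
  rw [← h1, ← h2]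
  exact tvDist_map_le (by fun_prop)

end Affine

/-! ### The parameters and approximation by the grid -/

section Parameters

variable {k n : ℕ} {M₀ : Set ((Fin k → ℝ) → ℝ)} {D : ℝ → ℝ} {net : ℝ → Finset M₀} {A α : ℝ}

theorem EntropyAssumption.etaN_spec (h : EntropyAssumption M₀ D net A α) (hn : 0 < n) :
    0 < etaN D n ∧ D (etaN D n) ≤ n * etaN D n ^ 2 / 24 := by
  have hn' : (0 : ℝ) < n := by exact_mod_cast hn
  set s := {η : ℝ | 0 < η ∧ D η ≤ n * η ^ 2 / 24} with hs
  have hne : s.Nonempty := by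
    have h1 := h.tendsto.eventually (gt_mem_nhds (show (0 : ℝ) < n / 24 by positivity))
    obtain ⟨η, h1, h2⟩ := (h1.and (eventually_gt_atTop 0)).exists
    refine ⟨η, h2, ?_⟩
    rw [div_lt_iff₀ (by positivity)] at h1
    linarith
  -- As `D ≥ 1`, the infimum stays away from 0, so `D` is continuous there and the defining
  -- inequality passes to the limit.
  have hlb : ∀ η ∈ s, √(24 / n) ≤ η := by
    rintro η ⟨h1, h2⟩
    refine Real.sqrt_le_iff.2 ⟨h1.le, ?_⟩
    rw [div_le_iff₀ hn']
    linarith [h.one_le η h1]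
  have hpos : 0 < etaN D n :=
    (show 0 < √(24 / (n : ℝ)) by positivity).trans_le (le_csInf hne hlb)
  refine ⟨hpos, ?_⟩
  have hcl : etaN D n ∈ closure s := csInf_mem_closure hne ⟨0, fun η hη => hη.1.le⟩
  refine ContinuousWithinAt.closure_le (f := D) (g := fun η => n * η ^ 2 / 24) hcl
    ((h.continuousOn _ hpos).mono fun η hη => hη.1) ?_ fun η hη => hη.2
  exact Continuous.continuousWithinAt (by fun_prop)

theorem EntropyAssumption.deltaN_pos (h : EntropyAssumption M₀ D net A α) (hn : 0 < n) :
    0 < deltaN D A α n :=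
  Real.rpow_pos_of_pos (div_pos (h.etaN_spec hn).1 (by linarith [h.A_pos])) _

/-- This calibrates the mesh δ: location and scale errors of size δ cost together A(δ^α + δ^α) =
η_n. -/
theorem EntropyAssumption.deltaN_rpow (h : EntropyAssumption M₀ D net A α) (hn : 0 < n) :
    2 * A * deltaN D A α n ^ α = etaN D n := by
  have hA := h.A_pos
  have hη := (h.etaN_spec hn).1
  rw [deltaN, ← Real.rpow_mul (by positivity), one_div_mul_cancel h.α_pos.ne', Real.rpow_one]
  field_simp

theorem EntropyAssumption.le_mul_betaN_sq (h : EntropyAssumption M₀ D net A α) (hn : 0 < n)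
    {K : ℝ} (hK : 1 < K) :
    n * K ^ 2 * etaN D n ^ 2 / 4 + 18.6 * (k + 1) ≤ n * betaN D k n K ^ 2 := by
  have hn' : (0 : ℝ) < n := by exact_mod_cast hn
  have hη := (h.etaN_spec hn).1
  have hs : √(18.6 * (k + 1) / n) ^ 2 = 18.6 * (k + 1) / n := Real.sq_sqrt (by positivity)
  have hc : 0 ≤ K * etaN D n * √(18.6 * (k + 1) / n) := by positivity
  have : K ^ 2 * etaN D n ^ 2 / 4 + 18.6 * (k + 1) / n ≤ betaN D k n K ^ 2 := by
    rw [betaN]; linarith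
  calc _ = n * (K ^ 2 * etaN D n ^ 2 / 4 + 18.6 * (k + 1) / n) := by field_simp
    _ ≤ _ := by gcongr

theorem log_one_add_abs_le {j x e : ℝ} (he : 0 ≤ e) (hx : |x| ≤ Real.exp e) (hj : |j - x| ≤ 1) :
    Real.log (1 + |j|) ≤ 2 + e := by
  have h1 : |j| ≤ |j - x| + |x| := by simpa using abs_add_le (j - x) x
  have h2 : 1 ≤ Real.exp e := Real.one_le_exp he
  calc Real.log (1 + |j|) ≤ Real.log (3 * Real.exp e) :=
        Real.log_le_log (by positivity) (by linarith)
    _ = Real.log 3 + e := by rw [Real.log_mul (by norm_num) (Real.exp_pos _).ne', Real.log_exp]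
    _ ≤ 2 + e := by linarith [Real.log_le_sub_one_of_pos (show (0 : ℝ) < 3 by norm_num)]

/-- The exponent is rounded up, so that the scale ratio is at least 1, the only regime covered by
the regularity assumption. -/
theorem exists_zpow_near {δ Λ σ : ℝ} (hδ : 0 < δ) (hσ : 0 < σ)
    (h : |Real.log σ| ≤ Λ * Real.log (1 + δ)) :
    ∃ (j : ℤ) (x : ℝ), |x| ≤ Λ ∧ |(j : ℝ) - x| ≤ 1 ∧ σ ≤ (1 + δ) ^ j ∧ (1 + δ) ^ j ≤ (1 + δ) * σ := by
  have hl : 0 < Real.log (1 + δ) := Real.log_pos (by linarith)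
  set x := Real.log σ / Real.log (1 + δ) with hx
  have hxl : x * Real.log (1 + δ) = Real.log σ := div_mul_cancel₀ _ hl.ne'
  have h1 := Int.le_ceil x
  have h2 := Int.ceil_lt_add_one x
  have hpos : 0 < (1 + δ) ^ ⌈x⌉ := zpow_pos (by linarith) _
  refine ⟨⌈x⌉, x, ?_, abs_le.2 ⟨by linarith, by linarith⟩, ?_, ?_⟩
  · rw [hx, abs_div, abs_of_pos hl, div_le_iff₀ hl]; exact h
  · rw [← Real.log_le_log_iff hσ hpos, Real.log_zpow, ← hxl]
    gcongr
  · rw [← Real.log_le_log_iff hpos (by positivity), Real.log_zpow,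
      Real.log_mul (by positivity) hσ.ne', ← hxl]
    nlinarith

/-- Every element of the restricted model is close to a grid point with a small weight. -/
theorem EntropyAssumption.exists_gridPoint (h : EntropyAssumption M₀ D net A α) (hn : 0 < n)
    (hM : ∀ p ∈ M₀, IsDensity p) {K : ℝ} (hK : 1 < K) {P : Model M₀}
    (hP : P ∈ restrictedModel M₀ (LambdaN D A α k n K)) :
    ∃ θ : net (etaN D n) × ℤ × (Fin k → ℤ),
      tvDist P.1 (gridPoint (deltaN_nonneg D h.A_pos α n) θ).1 ≤ 2 * etaN D n ∧
        gridWeight θ ≤ n * betaN D k n K ^ 2 := by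
  obtain ⟨hη, hDη⟩ := h.etaN_spec hn
  have hδ := h.deltaN_pos hn
  have hδη := h.deltaN_rpow hn
  have hβ := h.le_mul_betaN_sq hn hK
  have hn' : (0 : ℝ) < n := by exact_mod_cast hn
  obtain ⟨p, hp, m, σ, hσ, hPeq, hmax⟩ := hP
  obtain ⟨q, hq, hpq⟩ := h.cover _ hη p hp
  set δ := deltaN D A α n with hδdef
  set η := etaN D n with hηdef
  set e := (K ^ 2 - 1) * n * η ^ 2 / (48 * (k + 1)) with he_def
  have he : 0 ≤ e := by
    have : 0 ≤ K ^ 2 - 1 := by nlinarith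
    positivity
  have hlog : 0 < Real.log (1 + δ) := Real.log_pos (by linarith)
  -- The log log term in Λ_n is there for this product form: log σ / log(1 + δ), the exact grid
  -- coordinate of σ, is then at most `exp e` in absolute value.
  have hΛ : LambdaN D A α k n K = Real.exp e * Real.log (1 + δ) := by
    rw [LambdaN, Real.exp_add, Real.exp_log hlog]
  rw [hΛ, max_le_iff] at hmax
  obtain ⟨j₀, x₀, hx₀, hj₀, hle, hge⟩ := exists_zpow_near hδ hσ hmax.1
  set σ' := (1 + δ) ^ j₀ with hσ'def
  have hσ' : 0 < σ' := hσ.trans_le hle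
  -- The location is rounded down coordinatewise on the mesh `σ' * δ`, so its error relative to `σ'`
  -- is at most δ. One η comes from the net and one from this discretisation.
  refine ⟨⟨⟨q, hq⟩, j₀, fun i => ⌊m i / (σ' * δ)⌋⟩, ?_, ?_⟩
  · change tvDist P.1 (locScale q.1 (fun i => σ' * δ * (⌊m i / (σ' * δ)⌋ : ℝ)) σ') ≤ _
    set m' : Fin k → ℝ := fun i => σ' * δ * (⌊m i / (σ' * δ)⌋ : ℝ) with hm'
    have hqd := hM q.1 q.2
    have hpd := hM p hp
    have := hpd.isProbabilityMeasure_locScale m hσ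
    have := hqd.isProbabilityMeasure_locScale m hσ
    have := hqd.isProbabilityMeasure_locScale m' hσ'
    have h1 := (tvDist_locScale_le hpd hqd m hσ).trans hpq
    have hm : ‖(σ' / σ)⁻¹ • σ⁻¹ • (m' - m)‖ ≤ δ := by
      refine (pi_norm_le_iff_of_nonneg hδ.le).2 fun i => ?_
      have hs : 0 < σ' * δ := by positivity
      have e1 : σ' * δ * (m i / (σ' * δ)) = m i := mul_div_cancel₀ _ hs.ne'
      have e2 := mul_le_mul_of_nonneg_left (Int.floor_le (m i / (σ' * δ))) hs.le
      have e3 := mul_le_mul_of_nonneg_left (Int.lt_floor_add_one (m i / (σ' * δ))).le hs.le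
      have e4 : ((σ' / σ)⁻¹ • σ⁻¹ • (m' - m)) i = (m' i - m i) / σ' := by
        simp only [Pi.smul_apply, Pi.sub_apply, smul_eq_mul]
        field_simp
      rw [e4, Real.norm_eq_abs, abs_div, abs_of_pos hσ', div_le_iff₀ hσ', abs_le]
      constructor <;> simp only [hm'] <;> linarith
    have hs1 : 1 - 1 / (σ' / σ) ≤ δ := by
      rw [one_div_div, sub_le_iff_le_add, ← sub_le_iff_le_add', le_div_iff₀ hσ']
      nlinarith
    have hs0 : 0 ≤ 1 - 1 / (σ' / σ) := by
      rw [one_div_div, sub_nonneg, div_le_one hσ']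
      exact hle
    have h2 := (tvDist_locScale_le_standardized hqd m m' hσ hσ').trans
      ((h.regular q.1 q.2 (σ⁻¹ • (m' - m)) (σ' / σ) ((one_le_div hσ).2 hle)).trans
        (min_le_left _ _))
    have h3 : A * (‖(σ' / σ)⁻¹ • σ⁻¹ • (m' - m)‖ ^ α + (1 - 1 / (σ' / σ)) ^ α) ≤
        A * (δ ^ α + δ ^ α) := by
      have := h.A_pos
      have := h.α_pos.le
      gcongr
    rw [hPeq]
    have h4 := tvDist_triangle (P := locScale p m σ) (Q := locScale q.1 m σ)
      (R := locScale q.1 m' σ')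
    linarith
  · have hj : ∀ i, Real.log (1 + |((⌊m i / (σ' * δ)⌋ : ℤ) : ℝ)|) ≤ 2 + e := by
      intro i
      refine log_one_add_abs_le he (x := m i / (σ' * δ)) ?_ ?_
      · have e1 : |σ⁻¹ * m i| ≤ Real.exp e * δ := by
          refine (norm_le_pi_norm (σ⁻¹ • m) i).trans (hmax.2.trans ?_)
          gcongr
          linarith [Real.log_le_sub_one_of_pos (show 0 < 1 + δ by linarith)]
        rw [abs_mul, abs_inv, abs_of_pos hσ, inv_mul_le_iff₀ hσ] at e1
        rw [abs_div, abs_of_pos (by positivity : 0 < σ' * δ), div_le_iff₀ (by positivity)]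
        calc |m i| ≤ σ * (Real.exp e * δ) := e1
          _ ≤ σ' * (Real.exp e * δ) := by gcongr
          _ = _ := by ring
      · have e2 := Int.floor_le (m i / (σ' * δ))
        have e3 := Int.lt_floor_add_one (m i / (σ' * δ))
        exact abs_le.2 ⟨by linarith, by linarith⟩
    have hj0 := log_one_add_abs_le he hx₀ hj₀
    have hcard : Real.log (net η).card ≤ n * η ^ 2 / 24 := by
      refine le_trans ?_ hDη
      have hpos : (0 : ℝ) < (net η).card := by
        exact_mod_cast Finset.card_pos.2 ⟨q, hq⟩
      rw [Real.log_le_iff_le_exp hpos]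
      exact h.card_le _ hη
    have hπ : Real.log (Real.pi ^ 2 / 3 - 1) ≤ 2 := by
      have h1 := Real.pi_gt_three
      have h2 := Real.pi_lt_d2
      have h3 : 0 < Real.pi ^ 2 / 3 - 1 := by nlinarith
      have := Real.log_le_sub_one_of_pos h3
      nlinarith
    have hsum : ∑ i, Real.log (1 + |((⌊m i / (σ' * δ)⌋ : ℤ) : ℝ)|) ≤ k * (2 + e) :=
      (Finset.sum_le_sum fun i _ => hj i).trans_eq (by simp [mul_add])
    have hk : (0 : ℝ) < k + 1 := by positivity
    have hke : 2 * ((k + 1) * e) = (K ^ 2 - 1) * n * η ^ 2 / 24 := by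
      rw [he_def]; field_simp; ring
    have hπk : (k + 1) * Real.log (Real.pi ^ 2 / 3 - 1) ≤ (k + 1) * 2 := by gcongr
    have hpos : 0 ≤ n * K ^ 2 * η ^ 2 := by positivity
    -- The weight is at most 2(k+1) + nη²/24 + 2(k+1)(2 + e) = 6(k+1) + K²nη²/24, by the value of
    -- `e`; this is below the bound in `hβ`.
    simp only [gridWeight]
    linarith

end Parameters

/-! ### The grid prior is a probability measure -/

section Prior

theorem hasSum_inv_one_add_abs_sq :
    HasSum (fun j : ℤ => ((1 + |(j : ℝ)|) ^ 2)⁻¹) (Real.pi ^ 2 / 3 - 1) := by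
  have h1 : HasSum (fun n : ℕ => ((1 + |((n : ℤ) : ℝ)|) ^ 2)⁻¹) (Real.pi ^ 2 / 6) := by
    -- The term of index 0 in the zeta series is 1/0 = 0, so the shift by one leaves the sum
    -- unchanged. For the negative integers below, the shift removes the term 1 at j = 0.
    have h := (hasSum_nat_add_iff' 1).2 hasSum_zeta_two
    have e : (fun n : ℕ => ((1 + |((n : ℤ) : ℝ)|) ^ 2)⁻¹) =
        fun n : ℕ => 1 / (((n + 1 : ℕ) : ℝ)) ^ 2 := by
      ext n
      rw [one_div, Int.cast_natCast, abs_of_nonneg (Nat.cast_nonneg n)]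
      push_cast
      rw [add_comm]
    rw [e]
    simpa using h
  have h2 : HasSum (fun n : ℕ => ((1 + |((-((n : ℤ) + 1) : ℤ) : ℝ)|) ^ 2)⁻¹)
      (Real.pi ^ 2 / 6 - 1) := by
    have h := (hasSum_nat_add_iff' 1).2 h1
    have e : (fun n : ℕ => ((1 + |((-((n : ℤ) + 1) : ℤ) : ℝ)|) ^ 2)⁻¹) =
        fun n : ℕ => ((1 + |(((n + 1 : ℕ) : ℤ) : ℝ)|) ^ 2)⁻¹ := by
      ext n
      rw [Int.cast_neg, abs_neg]
      push_cast
      rfl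
    rw [e]
    simpa using h
  have h3 := HasSum.of_nat_of_neg_add_one (f := fun j : ℤ => ((1 + |(j : ℝ)|) ^ 2)⁻¹) h1 h2
  rwa [show Real.pi ^ 2 / 6 + (Real.pi ^ 2 / 6 - 1) = Real.pi ^ 2 / 3 - 1 by ring] at h3

theorem tsum_prod_pi (f : ℤ → ℝ≥0∞) (k : ℕ) :
    ∑' j : Fin k → ℤ, ∏ i, f (j i) = (∑' j, f j) ^ k := by
  induction k with
  | zero => simp [tsum_fintype]
  | succ k ih =>
    rw [← (Fin.consEquiv fun _ => ℤ).tsum_eq, pow_succ', ← ih]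
    simp only [Fin.consEquiv_apply, Fin.prod_univ_succ, Fin.cons_zero, Fin.cons_succ]
    rw [ENNReal.tsum_prod (f := fun (a : ℤ) (b : Fin k → ℤ) => f a * ∏ i, f (b i))]
    simp only [ENNReal.tsum_mul_left, ENNReal.tsum_mul_right]

variable {k : ℕ} {M₀ : Set ((Fin k → ℝ) → ℝ)} {N : Finset M₀}

/-- The mass factors over the net, the scale index and the location indices, so the total mass is a
product of one-dimensional sums. -/
theorem ofReal_exp_neg_gridWeight (θ : N × ℤ × (Fin k → ℤ)) :
    ENNReal.ofReal (Real.exp (-gridWeight θ)) =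
      ENNReal.ofReal (((Real.pi ^ 2 / 3 - 1) ^ (k + 1))⁻¹ * (N.card : ℝ)⁻¹) *
        (ENNReal.ofReal ((1 + |(θ.2.1 : ℝ)|) ^ 2)⁻¹ *
          ∏ i, ENNReal.ofReal ((1 + |(θ.2.2 i : ℝ)|) ^ 2)⁻¹) := by
  have hπ : 0 < Real.pi ^ 2 / 3 - 1 := by nlinarith [Real.pi_gt_three]
  have hN : (0 : ℝ) < N.card := by exact_mod_cast Finset.card_pos.2 ⟨_, θ.1.2⟩
  have hpos : ∀ j : ℤ, 0 < 1 + |(j : ℝ)| := fun j => by positivity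
  have hexp : ∀ j : ℤ, Real.exp (-(2 * Real.log (1 + |(j : ℝ)|))) = ((1 + |(j : ℝ)|) ^ 2)⁻¹ :=
    fun j => by
      rw [Real.exp_neg, ← Real.exp_log (pow_pos (hpos j) 2), Real.log_pow]; norm_num
  rw [← ENNReal.ofReal_prod_of_nonneg fun i _ => by positivity,
    ← ENNReal.ofReal_mul (by positivity), ← ENNReal.ofReal_mul (by positivity)]
  congr 1
  simp only [← hexp]
  rw [← Real.exp_sum, ← Real.exp_add]
  have h1 : ((Real.pi ^ 2 / 3 - 1) ^ (k + 1))⁻¹ =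
      Real.exp (-((k + 1) * Real.log (Real.pi ^ 2 / 3 - 1))) := by
    rw [Real.exp_neg, ← Real.exp_log (pow_pos hπ (k + 1)), Real.log_pow]; push_cast; rfl
  have h2 : (N.card : ℝ)⁻¹ = Real.exp (-Real.log N.card) := by
    rw [Real.exp_neg, Real.exp_log hN]
  rw [h1, h2, ← Real.exp_add, ← Real.exp_add, gridWeight, Finset.sum_neg_distrib, ← Finset.mul_sum]
  ring_nf

theorem tsum_exp_neg_gridWeight (hN : N.Nonempty) :
    ∑' θ : N × ℤ × (Fin k → ℤ), ENNReal.ofReal (Real.exp (-gridWeight θ)) = 1 := by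
  have hπ : 0 < Real.pi ^ 2 / 3 - 1 := by nlinarith [Real.pi_gt_three]
  have hN' : (0 : ℝ) < N.card := by exact_mod_cast hN.card_pos
  have hS : ∑' j : ℤ, ENNReal.ofReal ((1 + |(j : ℝ)|) ^ 2)⁻¹ =
      ENNReal.ofReal (Real.pi ^ 2 / 3 - 1) := by
    rw [← ENNReal.ofReal_tsum_of_nonneg (fun j => by positivity)
      hasSum_inv_one_add_abs_sq.summable, hasSum_inv_one_add_abs_sq.tsum_eq]
  simp only [ofReal_exp_neg_gridWeight]
  rw [ENNReal.tsum_mul_left, ENNReal.tsum_prod (f := fun (_ : N) (b : ℤ × (Fin k → ℤ)) =>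
    ENNReal.ofReal ((1 + |(b.1 : ℝ)|) ^ 2)⁻¹ * ∏ i, ENNReal.ofReal ((1 + |(b.2 i : ℝ)|) ^ 2)⁻¹),
    ENNReal.tsum_prod (f := fun (a : ℤ) (b : Fin k → ℤ) =>
    ENNReal.ofReal ((1 + |(a : ℝ)|) ^ 2)⁻¹ * ∏ i, ENNReal.ofReal ((1 + |(b i : ℝ)|) ^ 2)⁻¹)]
  simp only [ENNReal.tsum_mul_left, ENNReal.tsum_mul_right,
    tsum_prod_pi fun j : ℤ => ENNReal.ofReal ((1 + |(j : ℝ)|) ^ 2)⁻¹, hS]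
  rw [tsum_fintype, Finset.sum_const, Finset.card_univ, Fintype.card_coe, nsmul_eq_mul,
    ← ENNReal.ofReal_natCast, ← ENNReal.ofReal_pow hπ.le, ← ENNReal.ofReal_mul hN'.le,
    ← ENNReal.ofReal_mul hπ.le, ← ENNReal.ofReal_mul (by positivity), ← ENNReal.ofReal_one]
  congr 1
  generalize Real.pi ^ 2 / 3 - 1 = C at hπ
  field_simp
  ring

theorem isProbabilityMeasure_gridPrior (hN : N.Nonempty) {δ : ℝ} (hδ : 0 ≤ δ) :
    IsProbabilityMeasure (gridPrior N hδ) :=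
  ⟨by
    rw [gridPrior, Measure.sum_apply _ .univ]
    simp [tsum_exp_neg_gridWeight hN]⟩

/-- Distinct parameters may give the same distribution and their masses add up, hence only an
inequality. -/
theorem exp_neg_gridWeight_le_gridPrior {δ : ℝ} (hδ : 0 ≤ δ) (θ : N × ℤ × (Fin k → ℤ)) :
    Real.exp (-gridWeight θ) ≤ (gridPrior N hδ).real {gridPoint hδ θ} := by
  have := isProbabilityMeasure_gridPrior ⟨_, θ.1.2⟩ hδ
  rw [measureReal_def, ← ENNReal.ofReal_le_iff_le_toReal (measure_ne_top _ _)]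
  refine le_trans ?_ (Measure.le_sum (fun θ : N × ℤ × (Fin k → ℤ) =>
    ENNReal.ofReal (Real.exp (-gridWeight θ)) • Measure.dirac (gridPoint hδ θ)) θ _)
  simp

/-- The discrete prior is the image of a measure on the countable set of grid parameters. -/
theorem gridPrior_eq_map {δ : ℝ} (hδ : 0 ≤ δ) [MeasurableSpace (N × ℤ × (Fin k → ℤ))]
    [DiscreteMeasurableSpace (N × ℤ × (Fin k → ℤ))] :
    gridPrior N hδ = (Measure.sum fun θ : N × ℤ × (Fin k → ℤ) =>
      ENNReal.ofReal (Real.exp (-gridWeight θ)) • Measure.dirac θ).map (gridPoint hδ) := by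
  rw [Measure.map_sum (Measurable.of_discrete.aemeasurable), gridPrior]
  congr 1
  ext1 θ
  rw [Measure.map_smul, Measure.map_dirac' .of_discrete]

end Prior

/-! ### Comparison of the radius with the moment bounds -/

section Concentration

variable {k n : ℕ} {M₀ : Set ((Fin k → ℝ) → ℝ)} {D : ℝ → ℝ} {net : ℝ → Finset M₀} {A α : ℝ}

theorem EntropyAssumption.net_nonempty (h : EntropyAssumption M₀ D net A α) (hn : 0 < n)
    (hM : M₀.Nonempty) : (net (etaN D n)).Nonempty :=
  have ⟨_, hp⟩ := hM
  have ⟨q, hq, _⟩ := h.cover _ (h.etaN_spec hn).1 _ hp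
  ⟨q, hq⟩

theorem restrictedModel_nonempty (hM : M₀.Nonempty) {Λ : ℝ} (hΛ : 0 ≤ Λ) :
    (restrictedModel M₀ Λ).Nonempty :=
  have ⟨p, hp⟩ := hM
  ⟨⟨locScale p 0 1, p, hp, 0, 1, one_pos, rfl⟩, p, hp, 0, 1, one_pos, rfl, by simpa using hΛ⟩

/-- The concentration radius exceeds the threshold required by the exponential moment bounds. -/
theorem EntropyAssumption.radius_bound (h : EntropyAssumption M₀ D net A α) (hn : 0 < n)
    {K : ℝ} (hK : 1 < K) {ξ : ℝ} (hξ : 0 < ξ) (S : Measure (Fin k → ℝ)) {r L : ℝ}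
    (hr : r ≤ (⨅ P : restrictedModel M₀ (LambdaN D A α k n K), tvDist S P.1.1) + 3 * etaN D n)
    (hL : L ≤ n * betaN D k n K ^ 2) :
    11 / 4 * L + 5 * (n * betaN D k n K * r) + 29 / 36 * (n * betaN D k n K ^ 2) + 2 * ξ ≤
      n * betaN D k n K * (40 * radius M₀ D A α n K ξ S) / 2 := by
  have hη := (h.etaN_spec hn).1
  have hn' : (0 : ℝ) < n := by exact_mod_cast hn
  have hI : 0 ≤ ⨅ P : restrictedModel M₀ (LambdaN D A α k n K), tvDist S P.1.1 :=
    Real.iInf_nonneg fun _ => tvDist_nonneg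
  rw [radius]
  set I := ⨅ P : restrictedModel M₀ (LambdaN D A α k n K), tvDist S P.1.1
  set η := etaN D n
  set s := √(((k : ℝ) + 1) / n) with hs
  have hs0 : 0 ≤ s := Real.sqrt_nonneg _
  have hKη : η ≤ K * η := le_mul_of_one_le_left hη.le hK.le
  have hsq : √(18.6 * (k + 1) / n) = √18.6 * s := by
    rw [hs, ← Real.sqrt_mul (by norm_num), mul_div_assoc]
  have h5 : √18.6 ≤ 5 := Real.sqrt_le_iff.2 ⟨by norm_num, by norm_num⟩
  have h1 : 1 ≤ √18.6 := Real.one_le_sqrt.2 (by norm_num)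
  have hβ : betaN D k n K = 1 / 2 * (K * η) + √18.6 * s := by rw [betaN, hsq]; ring
  have hβle : betaN D k n K ≤ 1 / 2 * (K * η) + 5 * s := by rw [hβ]; gcongr
  have hβge : s ≤ betaN D k n K := by
    have := le_mul_of_one_le_left hs0 h1
    rw [hβ]; linarith
  have hsn : 1 / √n ≤ s := by
    rw [hs, one_div, ← Real.sqrt_inv]
    apply Real.sqrt_le_sqrt
    rw [inv_eq_one_div]
    gcongr
    linarith [Nat.cast_nonneg (α := ℝ) k]
  have hβpos : 0 < betaN D k n K := (show 0 < 1 / √(n : ℝ) by positivity).trans_le (hsn.trans hβge)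
  set β := betaN D k n K
  -- Since β ≥ √((k+1)/n) ≥ 1/√n, one has nβ ≥ √n, which absorbs ξ.
  have hξβ : ξ ≤ n * β * (ξ / √n) := by
    have h2 : n * (1 / √(n : ℝ)) * (ξ / √n) ≤ n * β * (ξ / √n) := by
      gcongr; exact hsn.trans hβge
    refine le_trans (le_of_eq ?_) h2
    have : √(n : ℝ) * √n = n := Real.mul_self_sqrt hn'.le
    field_simp
    rw [pow_two, this]
  have hnβ : 0 < n * β := by positivity
  have e1 : n * β * r ≤ n * β * (I + 3 * η) := by gcongr
  have e2 : n * β ^ 2 ≤ n * β * (1 / 2 * (K * η) + 5 * s) := by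
    rw [pow_two, ← mul_assoc]; gcongr
  have e3 : n * β * η ≤ n * β * (K * η) := by gcongr
  have e4 : 0 ≤ n * β * I := by positivity
  have e5 : 0 ≤ n * β * s := by positivity
  have e6 : 0 ≤ n * β * (K * η) := by positivity
  -- With 11/4 + 29/36 = 32/9, the left side is at most nβ times 5I + (15 + 16/9)Kη + (160/9)s +
  -- 2ξ/√n, and every coefficient is below 20 = 40/2.
  linarith

end Concentration

end LocationScale

open LocationScale in
theorem corollary3 :
    ∃ κ : ℝ, 0 < κ ∧
      ∀ (k n : ℕ), 0 < n →
      ∀ (M₀ : Set ((Fin k → ℝ) → ℝ)), M₀.Nonempty → (∀ p ∈ M₀, LocationScale.IsDensity p) →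
      ∀ (D : ℝ → ℝ) (net : ℝ → Finset M₀) (A α : ℝ)
        (h : LocationScale.EntropyAssumption M₀ D net A α)
        (dens : LocationScale.Model M₀ → (Fin k → ℝ) → ℝ),
        LocationScale.IsDensityChoice dens →
      ∀ (K : ℝ), 1 < K →
      ∀ (P : Fin n → Measure (Fin k → ℝ)) [∀ i, IsProbabilityMeasure (P i)] (ξ : ℝ), 0 < ξ →
        Measurable (fun x : Fin n → Fin k → ℝ =>
          LocationScale.gridPosterior h dens K x
            (LocationScale.ball M₀ (LocationScale.average P)
              (κ * LocationScale.radius M₀ D A α n K ξ (LocationScale.average P)))ᶜ) ∧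
        ∫⁻ x : Fin n → Fin k → ℝ,
          LocationScale.gridPosterior h dens K x
            (LocationScale.ball M₀ (LocationScale.average P)
              (κ * LocationScale.radius M₀ D A α n K ξ (LocationScale.average P)))ᶜ
          ∂(Measure.pi P) ≤ ENNReal.ofReal (2 * Real.exp (-ξ)) := by
  refine ⟨40, by norm_num, ?_⟩
  intro k n hn M₀ hM₀ hdens D net A α h dens hd K hK P _ ξ hξ
  have hη := (h.etaN_spec hn).1
  have hδ := deltaN_nonneg D h.A_pos α n
  have : IsProbabilityMeasure (average P) := isProbabilityMeasure_average hn
  let mΘ : MeasurableSpace (net (etaN D n) × ℤ × (Fin k → ℤ)) := ⊤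
  have : DiscreteMeasurableSpace (net (etaN D n) × ℤ × (Fin k → ℤ)) := ⟨fun _ => trivial⟩
  have : DiscreteMeasurableSpace (Model M₀) := ⟨fun _ => trivial⟩
  have hprior := isProbabilityMeasure_gridPrior (h.net_nonempty hn hM₀) hδ
  have hmap := gridPrior_eq_map (N := net (etaN D n)) hδ
  rw [hmap] at hprior
  simp only [gridPosterior, hmap]
  refine ⟨measurable_posterior_apply hd.measurable_tvTest _ _ _, ?_⟩
  have : Nonempty (restrictedModel M₀ (LambdaN D A α k n K)) :=
    (restrictedModel_nonempty hM₀ (Real.exp_pos _).le).to_subtype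
  -- The infimum need not be attained: a near-minimiser loses one η_n, and its grid approximation
  -- two more, hence the 3η_n in `radius_bound`.
  obtain ⟨⟨Q, hQ⟩, hQlt⟩ := exists_lt_of_ciInf_lt (lt_add_of_pos_right
    (⨅ P' : restrictedModel M₀ (LambdaN D A α k n K), tvDist (average P) P'.1.1) hη)
  obtain ⟨θ, hθ, hL⟩ := h.exists_gridPoint hn hdens hK hQ
  have := hd.isProbabilityMeasure Q
  have := hd.isProbabilityMeasure (gridPoint hδ θ)
  have hr := tvDist_triangle (P := average P) (Q := Q.1) (R := (gridPoint hδ θ).1)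
  have hβ : 0 < betaN D k n K := by
    rw [betaN]; positivity
  have hθπ := exp_neg_gridWeight_le_gridPrior hδ θ
  rw [hmap] at hθπ
  exact lintegral_posterior_le hd.measurable_tvTest hd.abs_tvTest_le tvTest_antisymm hθπ
    (r := fun Q => tvDist (average P) Q.1) (fun _ => tvDist_nonneg)
    (fun u hu Q => hd.lintegral_exp_testSum_le hn _ Q hu) hβ
    (h.radius_bound hn hK hξ (average P) (by linarith) hL)
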